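/- Let $P$ be a finite non-empty poset. Write $\mathcal{A}(P)$ for the set of antichains of $P$ (including the empty antichain), and let $\triangle_P$ be the set of weightings of $\mathcal{A}(P)$, i.e. of all $\alpha : \mathcal{A}(P)\to[0,\infty)$ with $\sum_{S\in\mathcal{A}(P)}\alpha(S)=1$. For $Q\subseteq P$ and $S\in\mathcal{A}(P)$, the shadow $\partial_Q S$ is the set of minimal elements of $\{y\in Q : x\le y \text{ for some } x\in S\}$; it is an antichain of $Q$. For $\alpha\in\triangle_P$, the induced weighting $\partial_Q\alpha$ on $\mathcal{A}(Q)$ is $(\partial_Q\alpha)(T)=\sum_{S\in\mathcal{A}(P):\,\partial_Q S=T}\alpha(S)$, and for a weighting $\beta$ on $\mathcal{A}(Q)$ let $H(\beta)=-\sum_{T\in\mathcal{A}(Q)}\beta(T)\log\beta(T)$ (natural logarithm, $0\log 0=0$). Define $$c_\star(P)=\sup\Bigl\{c\ge 0:\ \exists\,\alpha\in\triangle_P\ \text{ such that } c\le \frac{H(\partial_Q\alpha)}{|Q|}\ \text{ for every } \emptyset\ne Q\subseteq P\Bigr\}.$$ Let $\mathcal{P}(n)$ be the power set of $\{1,\dots,n\}$,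 ordered by inclusion, and let $\mathcal{P}(n,p)$ be the random induced subposet of $\mathcal{P}(n)$ obtained by retaining each element independently with probability $p$. **Theorem.** For every finite non-empty poset $P$, $$c_\star(P)=\max_{\alpha\in\triangle_P}\ \min_{\emptyset\ne Q\subseteq P}\ \frac{H(\partial_Q\alpha)}{|Q|},$$ and for every fixed $c>0$, with $p=p(n)=e^{-cn}$: 1. if $c>c_\star(P)$, then with probability tending to $1$ as $n\to\infty$ there is no injective order-preserving map $P\to\mathcal{P}(n,p)$ (that is, $P$ is not a subposet of $\mathcal{P}(n,p)$); 2. if $c<c_\star(P)$, then with probability tending to $1$ as $n\to\infty$ there is an injective map $\varphi:P\to\mathcal{P}(n,p)$ such that $\varphi(x)\subseteq\varphi(y)$ if and only if $x\le y$, for all $x,y\in P$ (that is, $P$ is an induced subposet of $\mathcal{P}(n,p)$). -/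

import Mathlib

open Filter Topology MeasureTheory

namespace RandomPoset

noncomputable section

open Classical in
/-- The finite collection of all antichains (including the empty one) of the subposet `Q` of `P`,
regarded as subsets of `P`. -/
def antichains {P : Type*} [PartialOrder P] (Q : Finset P) : Finset (Finset P) :=
  {S ∈ Q.powerset | IsAntichain (· ≤ ·) (S : Set P)}

/-- The index set of weightings: the antichains of the whole poset `P`. -/
abbrev Antichain (P : Type*) [PartialOrder P] [Fintype P] : Type _ :=
  {S : Finset P // S ∈ antichains (Finset.univ : Finset P)}

/-- The simplex of weightings: nonnegative weights on the antichains of `P` that sum to `1`. -/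
def weightings (P : Type*) [PartialOrder P] [Fintype P] : Set (Antichain P → ℝ) :=
  stdSimplex ℝ (Antichain P)

open Classical in
/-- The (upper) shadow of `S` in `Q`: the minimal elements of the set of all `y ∈ Q` that lie above
some element of `S`. -/
def shadow {P : Type*} [PartialOrder P] (Q S : Finset P) : Finset P :=
  {y ∈ Q | (∃ x ∈ S, x ≤ y) ∧ ∀ z ∈ Q, z < y → ∀ x ∈ S, ¬ x ≤ z}

open Classical in
/-- The weighting induced by `α` in `Q`: the weight of an antichain `T` of `Q` is the total weight
of the antichains of `P` whose shadow in `Q` is `T`. -/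
def inducedWeighting {P : Type*} [PartialOrder P] [Fintype P] (Q : Finset P)
    (α : Antichain P → ℝ) (T : Finset P) : ℝ :=
  ∑ S : Antichain P with shadow Q S.1 = T, α S

/-- The entropy, with natural logarithm and `0 log 0 = 0`, of the weighting `β` of the antichains
of `Q`. -/
def entropy {P : Type*} [PartialOrder P] (Q : Finset P) (β : Finset P → ℝ) : ℝ :=
  ∑ T ∈ antichains Q, -(β T * Real.log (β T))

/-- The critical exponent of `Q` in `P` with respect to `α`. -/
def exponentAt {P : Type*} [PartialOrder P] [Fintype P] (α : Antichain P → ℝ) (Q : Finset P) : ℝ :=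
  entropy Q (inducedWeighting Q α) / Q.card

/-- The critical exponent `c_⋆(P)` of the poset `P`. -/
def criticalExponent (P : Type*) [PartialOrder P] [Fintype P] : ℝ :=
  sSup {c : ℝ | 0 ≤ c ∧ ∃ α ∈ weightings P, ∀ Q : Finset P, Q.Nonempty → c ≤ exponentAt α Q}

/-- `P` is a subposet of `Q`: there is an injective order-preserving map from `P` to `Q`. -/
def IsSubposet (P Q : Type*) [PartialOrder P] [PartialOrder Q] : Prop :=
  ∃ φ : P → Q, Function.Injective φ ∧ ∀ x y, x ≤ y → φ x ≤ φ y

/-- `P` is an induced subposet of `Q`: there is an injective map from `P` to `Q` that preserves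
and reflects the order. -/
def IsInducedSubposet (P Q : Type*) [PartialOrder P] [PartialOrder Q] : Prop :=
  ∃ φ : P → Q, Function.Injective φ ∧ ∀ x y, φ x ≤ φ y ↔ x ≤ y

/-- The retention probability `p(n) = exp (-c n)`. -/
def retentionProb (c : ℝ) (hc : 0 < c) (n : ℕ) : unitInterval :=
  ⟨Real.exp (-c * n), (Real.exp_pos _).le,
    Real.exp_le_one_iff.2 (mul_nonpos_of_nonpos_of_nonneg (neg_nonpos.2 hc.le) n.cast_nonneg)⟩

/-- The law of the random poset `𝒫(n, p)`: every subset of an `n`-element set is retained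
independently with probability `p`. The members of the random family are ordered by inclusion. -/
def law (n : ℕ) (p : unitInterval) : Measure (Set (Finset (Fin n))) :=
  ProbabilityTheory.setBernoulli Set.univ p

end

end RandomPoset

namespace RandomPoset

noncomputable section

/-! An order-preserving map `φ` from `P` to the subsets of `Fin n` is the same thing as a word of
length `n` over the antichains of `P`: letter `i` consists of the minimal `x` with `i ∈ φ x`. The
restriction of `φ` to `Q` is encoded by the word of shadows in `Q`. If the letters have empirical
distribution `α`, there are about `exp (n * H(∂_Q α))` such restrictions, and each survives with
probability `exp (-c * n * |Q|)`. Thus `Q` is an obstruction exactly when its exponent is below `c`.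

Above the threshold: the empirical weighting of any embedding has a bottleneck `Q` with exponent at
most `c_⋆` (`exists_word_of_isSubposet`). A union bound over the words on `Q` is controlled by the
method of types (`sum_exp_neg_wordEntropy_le`).

Below it: fix a weighting of full support whose exponents all exceed `c`, and draw the letters
independently from it. Using the word probabilities as weights in a second moment argument
(`law_real_not_retained_mul_le`) avoids counting words of a given type. Only good words are used:
they reflect the order and all their projections are typical. A pair overlapping in `Q` gains `exp
(c * n * |Q|)`, but typicality makes such pairs rarer than that (`sum_overlap_le`). -/

/-! ### Antichains and shadows. -/

open Classical in
lemma mem_antichains {P : Type*} [PartialOrder P] {Q S : Finset P} :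
    S ∈ antichains Q ↔ S ⊆ Q ∧ IsAntichain (· ≤ ·) (S : Set P) := by
  simp [antichains]

lemma mem_shadow {P : Type*} [PartialOrder P] {Q S : Finset P} {y : P} :
    y ∈ shadow Q S ↔ y ∈ Q ∧ (∃ x ∈ S, x ≤ y) ∧ ∀ z ∈ Q, z < y → ∀ x ∈ S, ¬ x ≤ z := by
  simp [shadow]

lemma shadow_mem_antichains {P : Type*} [PartialOrder P] (Q S : Finset P) :
    shadow Q S ∈ antichains Q := by
  refine mem_antichains.2 ⟨fun y hy => (mem_shadow.1 hy).1, fun a ha b hb hab hle => ?_⟩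
  have ha' := mem_shadow.1 (Finset.mem_coe.1 ha)
  have hb' := mem_shadow.1 (Finset.mem_coe.1 hb)
  obtain ⟨x, hx, hxa⟩ := ha'.2.1
  exact hb'.2.2 a ha'.1 (lt_of_le_of_ne hle hab) x hx hxa

lemma exists_mem_shadow_le_iff {P : Type*} [PartialOrder P] {Q S : Finset P} {y : P} (hy : y ∈ Q) :
    (∃ t ∈ shadow Q S, t ≤ y) ↔ ∃ x ∈ S, x ≤ y := by
  constructor
  · rintro ⟨t, ht, hty⟩
    obtain ⟨x, hx, hxt⟩ := (mem_shadow.1 ht).2.1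
    exact ⟨x, hx, hxt.trans hty⟩
  · intro h
    have hfin : {z | z ∈ Q ∧ ∃ x ∈ S, x ≤ z}.Finite := Q.finite_toSet.subset fun z hz => hz.1
    obtain ⟨t, hty, ht⟩ := hfin.exists_le_minimal (a := y) ⟨hy, h⟩
    refine ⟨t, mem_shadow.2 ⟨ht.prop.1, ht.prop.2, fun z hz hzt x hx hxz => ?_⟩, hty⟩
    exact ht.not_prop_of_lt hzt ⟨hz, x, hx, hxz⟩

/-- The shadow of `S` in `Q` only depends on which elements of `Q` lie above an element of `S`. -/
lemma shadow_congr {P : Type*} [PartialOrder P] {Q S S' : Finset P}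
    (h : ∀ y ∈ Q, (∃ x ∈ S, x ≤ y) ↔ ∃ x ∈ S', x ≤ y) : shadow Q S = shadow Q S' := by
  ext y
  rw [mem_shadow, mem_shadow]
  refine and_congr_right fun hy => and_congr (h y hy) ?_
  refine forall₃_congr fun z hz _ => ?_
  have := h z hz
  constructor
  · intro h' x hx hxz
    obtain ⟨x', hx', hxz'⟩ := this.2 ⟨x, hx, hxz⟩
    exact h' x' hx' hxz'
  · intro h' x hx hxz
    obtain ⟨x', hx', hxz'⟩ := this.1 ⟨x, hx, hxz⟩
    exact h' x' hx' hxz'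

/-! ### Induced weightings and the maximin formula. -/

section Finite

variable {P : Type*} [PartialOrder P] [Fintype P]

lemma inducedWeighting_nonneg (Q : Finset P) {α : Antichain P → ℝ} (hα : α ∈ weightings P)
    (T : Finset P) : 0 ≤ inducedWeighting Q α T :=
  Finset.sum_nonneg fun S _ => hα.1 S

lemma le_inducedWeighting_shadow (Q : Finset P) {α : Antichain P → ℝ} (hα : α ∈ weightings P)
    (S : Antichain P) : α S ≤ inducedWeighting Q α (shadow Q S.1) := by
  classical
  exact Finset.single_le_sum (f := α) (fun S _ => hα.1 S) (by simp)

lemma inducedWeighting_le_one (Q : Finset P) {α : Antichain P → ℝ} (hα : α ∈ weightings P)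
    (T : Finset P) : inducedWeighting Q α T ≤ 1 := by
  classical
  rw [← hα.2]
  exact Finset.sum_le_sum_of_subset_of_nonneg (Finset.filter_subset _ _) fun S _ _ => hα.1 S

lemma inducedWeighting_eq_zero (Q : Finset P) (α : Antichain P → ℝ) {T : Finset P}
    (hT : T ∉ antichains Q) : inducedWeighting Q α T = 0 := by
  classical
  refine Finset.sum_eq_zero fun S hS => absurd ?_ hT
  rw [← (Finset.mem_filter.1 hS).2]
  exact shadow_mem_antichains Q S.1

/-- Change of variables: the induced weighting is the pushforward of `α` under the shadow map.
Letting `T` run over all subsets of `P` costs nothing, since every shadow is an antichain of `Q`. -/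
lemma sum_inducedWeighting_mul (Q : Finset P) (α : Antichain P → ℝ) (f : Finset P → ℝ) :
    ∑ T, inducedWeighting Q α T * f T = ∑ S, α S * f (shadow Q S.1) := by
  classical
  rw [← Finset.sum_fiberwise Finset.univ (fun S : Antichain P => shadow Q S.1)
    (fun S => α S * f (shadow Q S.1))]
  refine Finset.sum_congr rfl fun T _ => ?_
  rw [inducedWeighting, Finset.sum_mul]
  refine Finset.sum_congr (by congr!) fun S hS => ?_
  rw [(Finset.mem_filter.1 hS).2]

lemma entropy_eq_sum_univ (Q : Finset P) (α : Antichain P → ℝ) :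
    entropy Q (inducedWeighting Q α) = ∑ T, Real.negMulLog (inducedWeighting Q α T) := by
  classical
  rw [entropy]
  simp only [← neg_mul]
  refine Finset.sum_subset (Finset.subset_univ _) fun T _ hT => ?_
  simp [inducedWeighting_eq_zero Q α hT]

lemma exponentAt_nonneg {α : Antichain P → ℝ} (hα : α ∈ weightings P) (Q : Finset P) :
    0 ≤ exponentAt α Q := by
  rw [exponentAt, entropy_eq_sum_univ]
  exact div_nonneg (Finset.sum_nonneg fun T _ => Real.negMulLog_nonneg
    (inducedWeighting_nonneg Q hα T) (inducedWeighting_le_one Q hα T)) (Nat.cast_nonneg _)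

lemma continuous_exponentAt (Q : Finset P) :
    Continuous fun α : Antichain P → ℝ => exponentAt α Q := by
  simp only [exponentAt, entropy_eq_sum_univ]
  refine Continuous.div_const (continuous_finsetSum _ fun T _ =>
    Real.continuous_negMulLog.comp ?_) _
  unfold inducedWeighting
  fun_prop

/-- The antichain consisting of a single element. -/
def singletonAntichain (x : P) : Antichain P :=
  ⟨{x}, mem_antichains.2 ⟨Finset.subset_univ _, by simp⟩⟩

instance : Nonempty (Antichain P) :=
  ⟨⟨∅, mem_antichains.2 ⟨Finset.subset_univ _, by simp⟩⟩⟩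

/-- The uniform weighting. -/
def uniformWeighting (P : Type*) [PartialOrder P] [Fintype P] : Antichain P → ℝ :=
  fun _ => (Fintype.card (Antichain P) : ℝ)⁻¹

lemma uniformWeighting_mem : uniformWeighting P ∈ weightings P := by
  refine ⟨fun S => by unfold uniformWeighting; positivity, ?_⟩
  simp only [uniformWeighting, Finset.sum_const, Finset.card_univ, nsmul_eq_mul]
  exact mul_inv_cancel₀ (Nat.cast_ne_zero.2 Fintype.card_ne_zero)

/-- The hypotheses say that `α` maximizes the minimal exponent and that `Q` attains the minimum for
`α`. The constraint `0 ≤ c` in the definition is harmless because exponents are nonnegative. -/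
lemma criticalExponent_eq {α : Antichain P → ℝ} (hα : α ∈ weightings P) {Q : Finset P}
    (hmin : ∀ Q' : Finset P, Q'.Nonempty → exponentAt α Q ≤ exponentAt α Q')
    (hmax : ∀ α' ∈ weightings P, ∃ Q' : Finset P, Q'.Nonempty ∧
      exponentAt α' Q' ≤ exponentAt α Q) :
    criticalExponent P = exponentAt α Q := by
  refine IsGreatest.csSup_eq ⟨⟨exponentAt_nonneg hα Q, α, hα, hmin⟩, ?_⟩
  rintro c ⟨-, α', hα', hc⟩
  obtain ⟨Q', hQ', hle⟩ := hmax α' hα'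
  exact (hc Q' hQ').trans hle

variable [Nonempty P]

/-- A minimum of finitely many continuous functions is continuous, so it attains its maximum on the
compact simplex. -/
lemma exists_weighting_maximin :
    ∃ α ∈ weightings P, ∃ Q : Finset P, Q.Nonempty ∧
      (∀ Q' : Finset P, Q'.Nonempty → exponentAt α Q ≤ exponentAt α Q') ∧
      ∀ α' ∈ weightings P, ∃ Q' : Finset P, Q'.Nonempty ∧ exponentAt α' Q' ≤ exponentAt α Q := by
  classical
  let s : Finset (Finset P) := Finset.univ.filter Finset.Nonempty
  have hs : s.Nonempty := ⟨Finset.univ, by simp [s]⟩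
  let f : (Antichain P → ℝ) → ℝ := fun α => s.inf' hs fun Q => exponentAt α Q
  have hf : Continuous f := Continuous.finset_inf'_apply hs fun Q _ => continuous_exponentAt Q
  obtain ⟨α, hα, hmax⟩ := (isCompact_stdSimplex ℝ (Antichain P)).exists_isMaxOn
    ⟨_, uniformWeighting_mem⟩ hf.continuousOn
  obtain ⟨Q, hQ, hQf⟩ := s.exists_mem_eq_inf' hs fun Q => exponentAt α Q
  refine ⟨α, hα, Q, by simpa [s] using hQ, fun Q' hQ' => ?_, fun α' hα' => ?_⟩
  · rw [← hQf]
    exact Finset.inf'_le _ (by simpa [s] using hQ')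
  · obtain ⟨Q', hQ', hQf'⟩ := s.exists_mem_eq_inf' hs fun Q => exponentAt α' Q
    refine ⟨Q', by simpa [s] using hQ', ?_⟩
    rw [← hQf, ← hQf']
    exact hmax hα'

/-- The critical exponent is the maximum over all weightings of the minimum exponent. -/
theorem isGreatest_criticalExponent :
    IsGreatest {m : ℝ | ∃ α ∈ weightings P,
      IsLeast {x : ℝ | ∃ Q : Finset P, Q.Nonempty ∧ x = exponentAt α Q} m}
      (criticalExponent P) := by
  obtain ⟨α, hα, Q, hQ, hmin, hmax⟩ := exists_weighting_maximin (P := P)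
  rw [criticalExponent_eq hα hmin hmax]
  refine ⟨⟨α, hα, ⟨Q, hQ, rfl⟩, ?_⟩, ?_⟩
  · rintro x ⟨Q', hQ', rfl⟩
    exact hmin Q' hQ'
  · rintro m ⟨α', hα', -, hm⟩
    obtain ⟨Q', hQ', hle⟩ := hmax α' hα'
    exact (hm ⟨Q', hQ', rfl⟩).trans hle

lemma exists_exponentAt_le_criticalExponent {α : Antichain P → ℝ} (hα : α ∈ weightings P) :
    ∃ Q : Finset P, Q.Nonempty ∧ exponentAt α Q ≤ criticalExponent P := by
  obtain ⟨α₀, hα₀, Q, hQ, hmin, hmax⟩ := exists_weighting_maximin (P := P)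
  rw [criticalExponent_eq hα₀ hmin hmax]
  exact hmax α hα

/-- Below the critical exponent there are weightings of full support whose exponents are large. -/
lemma exists_pos_weighting_of_lt_criticalExponent {c : ℝ} (hc : c < criticalExponent P) :
    ∃ α ∈ weightings P, (∀ S, 0 < α S) ∧ ∀ Q : Finset P, Q.Nonempty → c < exponentAt α Q := by
  obtain ⟨α, hα, Q, hQ, hmin, hmax⟩ := exists_weighting_maximin (P := P)
  rw [criticalExponent_eq hα hmin hmax] at hc
  -- Mixing in a little of the uniform weighting makes every weight positive; finitely many strict
  -- inequalities survive by continuity.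
  let γ : ℝ → Antichain P → ℝ := fun t => (1 - t) • α + t • uniformWeighting P
  have hγ : Continuous γ := by fun_prop
  have h0 : γ 0 = α := by simp [γ]
  have hev : ∀ᶠ t in 𝓝 (0 : ℝ), ∀ Q' : Finset P, Q'.Nonempty → c < exponentAt (γ t) Q' := by
    refine eventually_all.2 fun Q' => ?_
    by_cases hQ' : Q'.Nonempty
    · have h1 : Tendsto (fun t => exponentAt (γ t) Q') (𝓝 0) (𝓝 (exponentAt α Q')) := by
        have := ((continuous_exponentAt Q').comp hγ).tendsto 0
        rwa [Function.comp_apply, h0] at this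
      filter_upwards [h1.eventually_const_lt (hc.trans_le (hmin Q' hQ'))] with t ht _ using ht
    · simp [hQ']
  have hev' : ∀ᶠ t in 𝓝[>] (0 : ℝ), t < 1 :=
    eventually_nhdsWithin_of_eventually_nhds (eventually_lt_nhds one_pos)
  obtain ⟨t, ht, ht1, ht0⟩ :=
    ((hev.filter_mono nhdsWithin_le_nhds).and (hev'.and self_mem_nhdsWithin)).exists
  have ht0 : 0 < t := ht0
  refine ⟨γ t, ?_, fun S => ?_, ht⟩
  · exact convex_stdSimplex ℝ _ hα uniformWeighting_mem (by linarith) ht0.le (by ring)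
  · have hu : 0 < uniformWeighting P S := by
      unfold uniformWeighting
      have := Fintype.card_pos (α := Antichain P)
      positivity
    have := hα.1 S
    have h1t : 0 < 1 - t := by linarith
    simp only [γ, Pi.add_apply, Pi.smul_apply, smul_eq_mul]
    positivity

end Finite

/-! ### Retention probabilities and the method of types. -/

/-- All members of the finite family `s` are retained with probability `p ^ #s`. -/
lemma law_real_subset (n : ℕ) (p : unitInterval) (s : Finset (Finset (Fin n))) :
    (law n p).real {F | ∀ A ∈ s, A ∈ F} = (p : ℝ) ^ s.card := by
  have h : (law n p) {F | ∀ A ∈ s, A ∈ F} = (unitInterval.toNNReal p : ENNReal) ^ s.card := by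
    rw [law, ProbabilityTheory.setBernoulli_apply']
    have : (fun q : Finset (Fin n) → Prop => {i | q i}) ⁻¹' {F | ∀ A ∈ s, A ∈ F} =
        Set.pi s (fun _ => {True}) := by
      ext q
      simp
    rw [this, Measure.infinitePi_pi _ fun _ _ => MeasurableSet.of_discrete]
    simp
  simp [measureReal_def, h]

instance (n : ℕ) (p : unitInterval) : IsProbabilityMeasure (law n p) := by
  unfold law; infer_instance

/-- The number of occurrences of the letter `a` in the word `u`. -/
def letterCount {A : Type*} [DecidableEq A] {n : ℕ} (u : Fin n → A) (a : A) : ℕ :=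
  (Finset.univ.filter fun i => u i = a).card

/-- The entropy of the empirical distribution of the letters of a word. -/
def wordEntropy {A : Type*} [Fintype A] [DecidableEq A] {n : ℕ} (u : Fin n → A) : ℝ :=
  ∑ a, Real.negMulLog (letterCount u a / n)

lemma sum_letterCount {A : Type*} [Fintype A] [DecidableEq A] {n : ℕ} (u : Fin n → A) :
    ∑ a, letterCount u a = n := by
  simpa [letterCount] using (Finset.card_eq_sum_card_fiberwise (f := u) (s := Finset.univ)
    (t := Finset.univ) (by simp)).symm

/-- The right side is the probability of `u` when letters are drawn independently from its own
empirical distribution. Words of one type share this distribution, so their probabilities add up to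
at most `1`. -/
lemma exp_neg_wordEntropy {A : Type*} [Fintype A] [DecidableEq A] {n : ℕ} (u : Fin n → A) :
    Real.exp (-(n * wordEntropy u)) = ∏ i, ((letterCount u (u i) : ℝ) / n) := by
  rcases Nat.eq_zero_or_pos n with rfl | hn
  · simp
  have hn' : (n : ℝ) ≠ 0 := by positivity
  rw [← Finset.prod_fiberwise Finset.univ u, wordEntropy, Finset.mul_sum, ← Finset.sum_neg_distrib,
    Real.exp_sum]
  refine Finset.prod_congr rfl fun a _ => ?_
  rw [Finset.prod_congr rfl (g := fun _ => (letterCount u a : ℝ) / n) fun i hi => by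
    rw [(Finset.mem_filter.1 hi).2], Finset.prod_const]
  change _ = _ ^ letterCount u a
  rcases Nat.eq_zero_or_pos (letterCount u a) with h | h
  · simp [h]
  rw [← Real.exp_log (x := (letterCount u a : ℝ) / n) (by positivity), ← Real.exp_nat_mul,
    Real.exp_log (by positivity), Real.negMulLog]
  congr 1
  field_simp

/-- The method of types: summing over the words of a fixed type gives at most `1`. -/
lemma sum_exp_neg_wordEntropy_le {A : Type*} [Fintype A] [DecidableEq A] (n : ℕ) :
    ∑ u : Fin n → A, Real.exp (-(n * wordEntropy u)) ≤ ((n : ℝ) + 1) ^ Fintype.card A := by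
  rcases Nat.eq_zero_or_pos n with rfl | hn
  · simp
  have hn' : (n : ℝ) ≠ 0 := by positivity
  let type : (Fin n → A) → (A → Fin (n + 1)) := fun u a =>
    ⟨letterCount u a, Nat.lt_succ_of_le ((Finset.card_le_univ _).trans_eq (by simp))⟩
  rw [← Finset.sum_fiberwise Finset.univ type]
  have key : ∀ k : A → Fin (n + 1),
      ∑ u with type u = k, Real.exp (-(n * wordEntropy u)) ≤ 1 := by
    intro k
    by_cases hk : ∃ u, type u = k
    · obtain ⟨u₀, rfl⟩ := hk
      calc ∑ u with type u = type u₀, Real.exp (-(n * wordEntropy u))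
          = ∑ u with type u = type u₀, ∏ i, ((letterCount u₀ (u i) : ℝ) / n) := by
            refine Finset.sum_congr rfl fun u hu => ?_
            rw [exp_neg_wordEntropy]
            refine Finset.prod_congr rfl fun i _ => ?_
            have := congrArg Fin.val (congrFun (Finset.mem_filter.1 hu).2 (u i))
            simp only [type] at this
            rw [this]
        _ ≤ ∑ u : Fin n → A, ∏ i, ((letterCount u₀ (u i) : ℝ) / n) :=
            Finset.sum_le_sum_of_subset_of_nonneg (Finset.filter_subset _ _) fun u _ _ =>
              Finset.prod_nonneg fun i _ => by positivity
        _ = (∑ a, (letterCount u₀ a : ℝ) / n) ^ n := by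
            rw [← Fintype.piFinset_univ, Finset.sum_pow']
        _ = 1 := by
            rw [← Finset.sum_div, ← Nat.cast_sum, sum_letterCount, div_self hn', one_pow]
    · rw [Finset.filter_false_of_mem fun u _ hu => hk ⟨u, hu⟩]
      simp
  refine (Finset.sum_le_sum fun k _ => key k).trans ?_
  simp

/-! ### Words as order-preserving maps, and the first moment bound. -/

section Words

open Classical in
/-- The order-preserving map to the power set of `Fin n` encoded by a word of subsets of `P`. -/
def wordMap {P : Type*} [PartialOrder P] {n : ℕ} (u : Fin n → Finset P) (y : P) : Finset (Fin n) :=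
  {i | ∃ t ∈ u i, t ≤ y}

lemma mem_wordMap {P : Type*} [PartialOrder P] {n : ℕ} {u : Fin n → Finset P} {y : P} {i : Fin n} :
    i ∈ wordMap u y ↔ ∃ t ∈ u i, t ≤ y := by
  simp [wordMap]

lemma wordMap_mono {P : Type*} [PartialOrder P] {n : ℕ} (u : Fin n → Finset P) {x y : P} (hxy : x ≤ y) :
    wordMap u x ≤ wordMap u y := by
  intro i hi
  obtain ⟨t, ht, htx⟩ := mem_wordMap.1 hi
  exact mem_wordMap.2 ⟨t, ht, htx.trans hxy⟩

lemma wordMap_shadow {P : Type*} [PartialOrder P] {n : ℕ} (u : Fin n → Finset P) {Q : Finset P}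
    {y : P} (hy : y ∈ Q) : wordMap (fun i => shadow Q (u i)) y = wordMap u y := by
  ext i
  rw [mem_wordMap, mem_wordMap, exists_mem_shadow_le_iff hy]

/-- With `wordMap_shadow`, this identifies the restrictions of encoded maps to `Q` with their words
of shadows. -/
lemma shadow_eq_of_wordMap_eq {P : Type*} [PartialOrder P] {n : ℕ} {u v : Fin n → Finset P}
    {Q : Finset P} (h : ∀ y ∈ Q, wordMap u y = wordMap v y) (i : Fin n) :
    shadow Q (u i) = shadow Q (v i) := by
  refine shadow_congr fun y hy => ?_
  rw [← mem_wordMap, ← mem_wordMap, h y hy]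

variable {P : Type*} [PartialOrder P] [Fintype P]

/-- Since `φ` is monotone, `{x | i ∈ φ x}` is an up-set, hence generated by its minimal elements;
these form letter `i`. -/
lemma exists_wordMap_eq {n : ℕ} {φ : P → Finset (Fin n)} (hφ : ∀ x y, x ≤ y → φ x ≤ φ y) :
    ∃ w : Fin n → Antichain P, wordMap (fun i => (w i).1) = φ := by
  classical
  refine ⟨fun i => ⟨shadow Finset.univ {x | i ∈ φ x}, shadow_mem_antichains _ _⟩, ?_⟩
  funext y
  ext i
  rw [mem_wordMap, exists_mem_shadow_le_iff (Finset.mem_univ y)]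
  constructor
  · rintro ⟨x, hx, hxy⟩
    exact hφ x y hxy (by simpa using hx)
  · intro h
    exact ⟨y, by simpa using h, le_rfl⟩

open Classical in
/-- The empirical weighting of the letters of a word. -/
def empiricalWeighting {n : ℕ} (w : Fin n → Antichain P) : Antichain P → ℝ :=
  fun S => letterCount w S / n

lemma empiricalWeighting_mem {n : ℕ} (hn : 0 < n) (w : Fin n → Antichain P) :
    empiricalWeighting w ∈ weightings P := by
  classical
  refine ⟨fun S => by unfold empiricalWeighting; positivity, ?_⟩
  unfold empiricalWeighting
  rw [← Finset.sum_div, ← Nat.cast_sum, sum_letterCount, div_self (by positivity)]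

-- The pushforward of an empirical distribution is the empirical distribution of the projected word.
open Classical in
lemma entropy_empiricalWeighting {n : ℕ} (w : Fin n → Antichain P) (Q : Finset P) :
    entropy Q (inducedWeighting Q (empiricalWeighting w)) =
      wordEntropy fun i => shadow Q (w i).1 := by
  rw [entropy_eq_sum_univ, wordEntropy]
  refine Finset.sum_congr rfl fun T _ => ?_
  congr 1
  unfold inducedWeighting empiricalWeighting
  rw [← Finset.sum_div, ← Nat.cast_sum]
  congr 2
  simp only [letterCount]
  rw [Finset.card_eq_sum_card_fiberwise (f := w)
    (t := Finset.univ.filter fun S : Antichain P => shadow Q S.1 = T)]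
  · refine Finset.sum_congr (by congr!) fun S hS => ?_
    congr 1
    ext i
    have := (Finset.mem_filter.1 hS).2
    simp only [Finset.mem_filter, Finset.mem_univ, true_and]
    constructor
    · rintro rfl
      exact ⟨this, rfl⟩
    · exact And.right
  · intro i hi
    simpa using hi

variable [Nonempty P]

open Classical in
/-- If `P` is a subposet of `F`, then some nonempty `Q ⊆ P` is mapped injectively into `F` by a word
of low entropy. -/
lemma exists_word_of_isSubposet {n : ℕ} (hn : 0 < n) {F : Set (Finset (Fin n))}
    (h : IsSubposet P F) :
    ∃ Q : Finset P, Q.Nonempty ∧ ∃ u : Fin n → Finset P, Set.InjOn (wordMap u) Q ∧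
      wordEntropy u ≤ criticalExponent P * Q.card ∧ ∀ A ∈ Q.image (wordMap u), A ∈ F := by
  obtain ⟨φ, hinj, hφ⟩ := h
  obtain ⟨w, hw⟩ := exists_wordMap_eq (φ := fun x => (φ x).1) hφ
  -- The empirical weighting cannot beat the maximin value, which yields the bottleneck `Q`.
  obtain ⟨Q, hQ, hle⟩ := exists_exponentAt_le_criticalExponent (empiricalWeighting_mem hn w)
  have hmap : ∀ y ∈ Q, wordMap (fun i => shadow Q (w i).1) y = (φ y).1 := fun y hy => by
    rw [wordMap_shadow _ hy, hw]
  refine ⟨Q, hQ, fun i => shadow Q (w i).1, ?_, ?_, ?_⟩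
  · intro x hx y hy hxy
    rw [hmap x hx, hmap y hy] at hxy
    exact hinj (Subtype.ext hxy)
  · rw [← entropy_empiricalWeighting]
    exact (div_le_iff₀ (by exact_mod_cast hQ.card_pos)).1 hle
  · intro A hA
    obtain ⟨y, hy, rfl⟩ := Finset.mem_image.1 hA
    rw [hmap y hy]
    exact (φ y).2

/-- Union bound: `2 ^ |P|` counts the sets `Q`, and the polynomial factor comes from the method of
types. -/
lemma law_real_isSubposet_le {c : ℝ} (hc : 0 < c) (h : criticalExponent P < c) {n : ℕ}
    (hn : 0 < n) :
    (law n (retentionProb c hc n)).real {F | IsSubposet P F} ≤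
      2 ^ Fintype.card P * (((n : ℝ) + 1) ^ Fintype.card (Finset P) *
        Real.exp (-((c - criticalExponent P) * n))) := by
  classical
  let μ := law n (retentionProb c hc n)
  let words : Finset P → Finset (Fin n → Finset P) := fun Q => Finset.univ.filter fun u =>
    Set.InjOn (wordMap u) Q ∧ wordEntropy u ≤ criticalExponent P * Q.card
  let Qs : Finset (Finset P) := Finset.univ.filter Finset.Nonempty
  have hsub : {F : Set (Finset (Fin n)) | IsSubposet P F} ⊆
      ⋃ Q ∈ Qs, ⋃ u ∈ words Q, {F | ∀ A ∈ Q.image (wordMap u), A ∈ F} := by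
    intro F hF
    obtain ⟨Q, hQ, u, hinj, hle, hF'⟩ := exists_word_of_isSubposet hn hF
    simp only [Set.mem_iUnion]
    exact ⟨Q, by simpa [Qs] using hQ, u, by simp [words, hinj, hle], hF'⟩
  have hword : ∀ Q ∈ Qs, ∀ u ∈ words Q, μ.real {F | ∀ A ∈ Q.image (wordMap u), A ∈ F} ≤
      Real.exp (-((c - criticalExponent P) * n)) * Real.exp (-(n * wordEntropy u)) := by
    intro Q hQ u hu
    have hQ : 1 ≤ Q.card := (Finset.mem_filter.1 hQ).2.card_pos
    obtain ⟨hinj, hle⟩ := (Finset.mem_filter.1 hu).2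
    rw [law_real_subset, Finset.card_image_of_injOn hinj, retentionProb, ← Real.exp_nat_mul,
      ← Real.exp_add, Real.exp_le_exp]
    have hQ' : (1 : ℝ) ≤ Q.card := by exact_mod_cast hQ
    have h1 := mul_le_mul_of_nonneg_left hle (Nat.cast_nonneg (α := ℝ) n)
    -- Since `|Q| ≥ 1`, at least one factor `exp (-(c - c_⋆) * n)` is left over after `exp (-c_⋆ * n
    -- * |Q|)` has been absorbed into `exp (-n * H(u))`.
    have h2 : 0 ≤ ((c - criticalExponent P) * n) * (Q.card - 1 : ℝ) :=
      mul_nonneg (mul_nonneg (by linarith) n.cast_nonneg) (by linarith)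
    nlinarith
  calc μ.real {F | IsSubposet P F}
      ≤ μ.real (⋃ Q ∈ Qs, ⋃ u ∈ words Q, {F | ∀ A ∈ Q.image (wordMap u), A ∈ F}) :=
        measureReal_mono hsub (measure_ne_top (law n _) _)
    _ ≤ ∑ Q ∈ Qs, μ.real (⋃ u ∈ words Q, {F | ∀ A ∈ Q.image (wordMap u), A ∈ F}) :=
        measureReal_biUnion_finset_le _ _
    _ ≤ ∑ Q ∈ Qs, ∑ u ∈ words Q, μ.real {F | ∀ A ∈ Q.image (wordMap u), A ∈ F} :=
        Finset.sum_le_sum fun Q _ => measureReal_biUnion_finset_le _ _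
    _ ≤ ∑ Q ∈ Qs, ∑ u ∈ words Q,
          Real.exp (-((c - criticalExponent P) * n)) * Real.exp (-(n * wordEntropy u)) :=
        Finset.sum_le_sum fun Q hQ => Finset.sum_le_sum fun u hu => hword Q hQ u hu
    _ ≤ ∑ Q ∈ Qs, Real.exp (-((c - criticalExponent P) * n)) *
          ((n : ℝ) + 1) ^ Fintype.card (Finset P) := by
        refine Finset.sum_le_sum fun Q _ => ?_
        rw [← Finset.mul_sum]
        refine mul_le_mul_of_nonneg_left ?_ (Real.exp_pos _).le
        exact (Finset.sum_le_sum_of_subset_of_nonneg (Finset.subset_univ _)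
          fun u _ _ => (Real.exp_pos _).le).trans (sum_exp_neg_wordEntropy_le n)
    _ ≤ ∑ Q : Finset P, Real.exp (-((c - criticalExponent P) * n)) *
          ((n : ℝ) + 1) ^ Fintype.card (Finset P) :=
        Finset.sum_le_sum_of_subset_of_nonneg (Finset.subset_univ _) fun Q _ _ => by positivity
    _ = _ := by
        simp [mul_comm]

lemma tendsto_add_one_pow_mul_exp_neg {ε : ℝ} (hε : 0 < ε) (k : ℕ) :
    Tendsto (fun n : ℕ => ((n : ℝ) + 1) ^ k * Real.exp (-(ε * n))) atTop (𝓝 0) := by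
  have h1 := Real.tendsto_pow_mul_exp_neg_atTop_nhds_zero k
  have h2 : Tendsto (fun n : ℕ => ε * ((n : ℝ) + 1)) atTop atTop :=
    Tendsto.const_mul_atTop hε (tendsto_atTop_add_const_right _ _ tendsto_natCast_atTop_atTop)
  have h3 := (h1.comp h2).const_mul (Real.exp ε / ε ^ k)
  rw [mul_zero] at h3
  refine h3.congr fun n => ?_
  simp only [Function.comp_apply]
  rw [show -(ε * n) = ε + -(ε * ((n : ℝ) + 1)) by ring, Real.exp_add]
  rw [mul_pow]
  field_simp

/-- A probability tends to `1` if a bound for the complementary probability tends to `0`. -/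
lemma tendsto_law_one {p : ℕ → unitInterval} {E : ∀ n, Set (Set (Finset (Fin n)))} {b : ℕ → ℝ}
    (hb : Tendsto b atTop (𝓝 0)) (h : ∀ᶠ n in atTop, (law n (p n)).real (E n)ᶜ ≤ b n) :
    Tendsto (fun n => law n (p n) (E n)) atTop (𝓝 1) := by
  have hreal : Tendsto (fun n => (law n (p n)).real (E n)) atTop (𝓝 1) := by
    have h1 : Tendsto (fun n => 1 - b n) atTop (𝓝 1) := by simpa using hb.const_sub 1
    refine tendsto_of_tendsto_of_tendsto_of_le_of_le' h1 tendsto_const_nhds ?_ ?_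
    · filter_upwards [h] with n hn
      have := measureReal_union_le (μ := law n (p n)) (E n) (E n)ᶜ
      rw [Set.union_compl_self, probReal_univ] at this
      linarith
    · exact Eventually.of_forall fun n => measureReal_le_one
  have := ENNReal.tendsto_ofReal hreal
  simpa [measureReal_def] using this

/-- Above the critical exponent, `P` is with high probability not a subposet. -/
theorem tendsto_law_not_isSubposet {c : ℝ} (hc : 0 < c) (h : criticalExponent P < c) :
    Tendsto (fun n : ℕ => law n (retentionProb c hc n)
      {F : Set (Finset (Fin n)) | ¬ IsSubposet P F}) atTop (𝓝 1) := by
  have hb := (tendsto_add_one_pow_mul_exp_neg (sub_pos.2 h)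
    (Fintype.card (Finset P))).const_mul ((2 : ℝ) ^ Fintype.card P)
  rw [mul_zero] at hb
  refine tendsto_law_one hb ?_
  filter_upwards [eventually_gt_atTop 0] with n hn
  have : {F : Set (Finset (Fin n)) | ¬ IsSubposet P F}ᶜ =
      {F : Set (Finset (Fin n)) | IsSubposet P F} := by
    ext F; simp
  rw [this]
  exact law_real_isSubposet_le hc h hn

end Words

/-! ### The weighted second moment method. -/

section SecondMoment

/-- The indicator of the event that all members of `s` are retained. -/
def retained {n : ℕ} (s : Finset (Finset (Fin n))) : Set (Finset (Fin n)) → ℝ :=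
  Set.indicator {F | ∀ A ∈ s, A ∈ F} 1

lemma retained_mul {n : ℕ} (s t : Finset (Finset (Fin n))) (F : Set (Finset (Fin n))) :
    retained s F * retained t F = retained (s ∪ t) F := by
  classical
  simp only [retained, Set.indicator_apply, Set.mem_ofPred_eq, Pi.one_apply, Finset.mem_union,
    or_imp, forall_and]
  split_ifs <;> simp_all

lemma integral_retained {n : ℕ} (p : unitInterval) (s : Finset (Finset (Fin n))) :
    ∫ F, retained s F ∂(law n p) = (p : ℝ) ^ s.card := by
  unfold retained
  rw [integral_indicator_one (Set.toFinite _).measurableSet, law_real_subset]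

/-- The weighted second moment method: a weighted collection of families of size `k` has some
member that is retained unless the contribution of the overlapping pairs is large. -/
lemma law_real_not_retained_mul_le {n : ℕ} {p : unitInterval} (hp : 0 < (p : ℝ)) {I : Type*}
    (G : Finset I) (a : I → ℝ) (ha : ∀ i, 0 ≤ a i) (s : I → Finset (Finset (Fin n))) {k : ℕ}
    (hs : ∀ i ∈ G, (s i).card = k) :
    (law n p).real {F | ∀ i ∈ G, ¬ ∀ A ∈ s i, A ∈ F} * (∑ i ∈ G, a i) ^ 2 ≤
      ∑ i ∈ G, ∑ j ∈ G, if s i ∩ s j = ∅ then 0 else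
        a i * a j * ((p : ℝ)⁻¹) ^ (s i ∩ s j).card := by
  classical
  let X : Set (Finset (Fin n)) → ℝ := fun F => ∑ i ∈ G, a i * retained (s i) F
  let W := ∑ i ∈ G, a i
  let m := (p : ℝ) ^ k * W
  let E : Set (Set (Finset (Fin n))) := {F | ∀ i ∈ G, ¬ ∀ A ∈ s i, A ∈ F}
  have hX : ∫ F, X F ∂(law n p) = m := by
    simp only [X]
    rw [integral_finsetSum _ fun _ _ => Integrable.of_finite]
    simp only [integral_const_mul, integral_retained, m, W, Finset.mul_sum]
    exact Finset.sum_congr rfl fun i hi => by rw [hs i hi, mul_comm]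
  have hX2 : ∫ F, X F ^ 2 ∂(law n p) =
      ∑ i ∈ G, ∑ j ∈ G, a i * a j * (p : ℝ) ^ (s i ∪ s j).card := by
    have : ∀ F, X F ^ 2 = ∑ i ∈ G, ∑ j ∈ G, a i * a j * retained (s i ∪ s j) F := by
      intro F
      simp only [X, sq, Finset.sum_mul_sum]
      refine Finset.sum_congr rfl fun i _ => Finset.sum_congr rfl fun j _ => ?_
      rw [← retained_mul]
      ring
    simp only [this]
    rw [integral_finsetSum _ fun _ _ => Integrable.of_finite]
    refine Finset.sum_congr rfl fun i _ => ?_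
    rw [integral_finsetSum _ fun _ _ => Integrable.of_finite]
    refine Finset.sum_congr rfl fun j _ => ?_
    rw [integral_const_mul, integral_retained]
  have hvar : ∫ F, (X F - m) ^ 2 ∂(law n p) = ∫ F, X F ^ 2 ∂(law n p) - m ^ 2 := by
    have : ∀ F, (X F - m) ^ 2 = X F ^ 2 - (2 * m * X F - m ^ 2) := fun F => by ring
    simp only [this]
    rw [integral_sub Integrable.of_finite Integrable.of_finite,
      integral_sub Integrable.of_finite Integrable.of_finite, integral_const_mul, hX,
      integral_const, probReal_univ]
    simp only [smul_eq_mul]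
    ring
  -- Chebyshev: `X` vanishes on `E`, so `(X - m) ^ 2 = m ^ 2` there.
  have hE : (law n p).real E * m ^ 2 ≤ ∫ F, (X F - m) ^ 2 ∂(law n p) := by
    rw [← smul_eq_mul, ← integral_indicator_const _ (Set.toFinite E).measurableSet]
    refine integral_mono Integrable.of_finite Integrable.of_finite fun F => ?_
    by_cases hF : F ∈ E
    · have : X F = 0 := Finset.sum_eq_zero fun i hi => by
        rw [retained, Set.indicator_of_notMem (show F ∉ {F | ∀ A ∈ s i, A ∈ F} from hF i hi),
          mul_zero]
      simp only [Set.indicator_of_mem hF, this]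
      exact le_of_eq (by ring)
    · simp only [Set.indicator_of_notMem hF]
      positivity
  have hbound : ∫ F, X F ^ 2 ∂(law n p) - m ^ 2 ≤ ((p : ℝ) ^ k) ^ 2 *
      ∑ i ∈ G, ∑ j ∈ G, if s i ∩ s j = ∅ then 0 else
        a i * a j * ((p : ℝ)⁻¹) ^ (s i ∩ s j).card := by
    have hm : m ^ 2 = ∑ i ∈ G, ∑ j ∈ G, a i * a j * ((p : ℝ) ^ k) ^ 2 := by
      simp only [m, W]
      rw [mul_pow, sq (∑ i ∈ G, a i), Finset.sum_mul_sum]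
      simp only [Finset.mul_sum]
      exact Finset.sum_congr rfl fun i _ => Finset.sum_congr rfl fun j _ => by ring
    rw [hX2, hm, ← Finset.sum_sub_distrib, Finset.mul_sum]
    refine Finset.sum_le_sum fun i hi => ?_
    rw [← Finset.sum_sub_distrib, Finset.mul_sum]
    refine Finset.sum_le_sum fun j hj => ?_
    have hcard := Finset.card_union_add_card_inter (s i) (s j)
    rw [hs i hi, hs j hj] at hcard
    -- By inclusion-exclusion the union has `2k - |s i ∩ s j|` members. Disjoint pairs therefore
    -- cancel against `m ^ 2`, and for the other pairs the subtracted term is dropped.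
    have hpow : (p : ℝ) ^ (s i ∪ s j).card =
        ((p : ℝ) ^ k) ^ 2 * ((p : ℝ)⁻¹) ^ (s i ∩ s j).card := by
      rw [← pow_mul, mul_two, ← hcard, pow_add, mul_assoc, ← mul_pow, mul_inv_cancel₀ hp.ne',
        one_pow, mul_one]
    rw [hpow]
    split_ifs with h
    · simp [h]
    · have := mul_nonneg (mul_nonneg (ha i) (ha j)) (sq_nonneg ((p : ℝ) ^ k))
      linarith
  have hpk : 0 < ((p : ℝ) ^ k) ^ 2 := by positivity
  refine le_of_mul_le_mul_left ?_ hpk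
  refine le_trans (le_of_eq ?_) (hE.trans (hvar.le.trans hbound))
  simp only [m, W, E]
  ring

end SecondMoment

/-! ### Random words and typicality. -/

section Words

variable {P : Type*} [PartialOrder P] [Fintype P]

/-- The probability of a word with independent letters distributed according to `α`. -/
def wordWeight {n : ℕ} (α : Antichain P → ℝ) (w : Fin n → Antichain P) : ℝ :=
  ∏ i, α (w i)

lemma wordWeight_nonneg {α : Antichain P → ℝ} (hα : α ∈ weightings P) {n : ℕ}
    (w : Fin n → Antichain P) : 0 ≤ wordWeight α w :=
  Finset.prod_nonneg fun _ _ => hα.1 _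

lemma sum_wordWeight {α : Antichain P → ℝ} (hα : α ∈ weightings P) (n : ℕ) :
    ∑ w : Fin n → Antichain P, wordWeight α w = 1 := by
  simp only [wordWeight]
  rw [← Fintype.piFinset_univ, ← Finset.sum_pow', hα.2, one_pow]

-- Projecting a word of independent letters to `Q` gives independent letters with the induced law.
open Classical in
lemma sum_wordWeight_shadow_eq (α : Antichain P → ℝ) (Q : Finset P) {n : ℕ}
    (u : Fin n → Finset P) :
    ∑ w : Fin n → Antichain P with ∀ i, shadow Q (w i).1 = u i, wordWeight α w =
      ∏ i, inducedWeighting Q α (u i) := by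
  simp only [wordWeight, inducedWeighting]
  rw [Finset.prod_univ_sum]
  refine Finset.sum_congr ?_ fun _ _ => rfl
  ext w
  simp [Fintype.mem_piFinset]

open Classical in
lemma sum_wordWeight_avoid {α : Antichain P → ℝ} (hα : α ∈ weightings P) (S : Antichain P)
    (n : ℕ) :
    ∑ w : Fin n → Antichain P with ∀ i, w i ≠ S, wordWeight α w = (1 - α S) ^ n := by
  simp only [wordWeight]
  have : (Finset.univ.filter fun w : Fin n → Antichain P => ∀ i, w i ≠ S) =
      Fintype.piFinset fun _ => Finset.univ.erase S := by
    ext w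
    simp [Fintype.mem_piFinset]
  rw [this, ← Finset.sum_pow', ← hα.2, ← Finset.sum_erase_add _ _ (Finset.mem_univ S),
    add_sub_cancel_right]

lemma entropy_inducedWeighting_eq (α : Antichain P → ℝ) (Q : Finset P) :
    entropy Q (inducedWeighting Q α) =
      -∑ S, α S * Real.log (inducedWeighting Q α (shadow Q S.1)) := by
  rw [entropy_eq_sum_univ, ← sum_inducedWeighting_mul Q α fun T => Real.log (inducedWeighting Q α T),
    ← Finset.sum_neg_distrib]
  exact Finset.sum_congr rfl fun T _ => by rw [Real.negMulLog, neg_mul]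

/-- Chernoff's method: as a function of `s` the sum equals `1` at `0` and has derivative `h` minus
the entropy there, which is negative; hence it drops below `1` for some `s > 0`. -/
lemma exists_exp_moment_lt_one {α : Antichain P → ℝ} (hα : α ∈ weightings P) (Q : Finset P) {h : ℝ}
    (hh : h < entropy Q (inducedWeighting Q α)) :
    ∃ s : ℝ, 0 < s ∧
      ∑ S, α S * Real.exp (s * (h + Real.log (inducedWeighting Q α (shadow Q S.1)))) < 1 := by
  let ℓ : Antichain P → ℝ := fun S => h + Real.log (inducedWeighting Q α (shadow Q S.1))
  let g : ℝ → ℝ := fun s => ∑ S, α S * Real.exp (s * ℓ S)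
  have hg0 : g 0 = 1 := by simpa [g] using hα.2
  have hderiv : HasDerivAt g (∑ S, α S * ℓ S) 0 := by
    refine HasDerivAt.fun_sum fun S _ => ?_
    have := (((hasDerivAt_id (0 : ℝ)).mul_const (ℓ S)).exp).const_mul (α S)
    simpa using this
  have hneg : ∑ S, α S * ℓ S < 0 := by
    simp only [ℓ, mul_add, Finset.sum_add_distrib, ← Finset.sum_mul]
    rw [hα.2]
    rw [entropy_inducedWeighting_eq] at hh
    linarith
  have hslope := (hasDerivAt_iff_tendsto_slope.1 hderiv).eventually_lt_const hneg
  have hslope' : ∀ᶠ s in 𝓝[>] (0 : ℝ), slope g 0 s < 0 :=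
    hslope.filter_mono (nhdsWithin_mono _ fun _ hs => ne_of_gt hs)
  obtain ⟨s, hs, hs0⟩ := (hslope'.and self_mem_nhdsWithin).exists
  have hs0 : 0 < s := hs0
  refine ⟨s, hs0, ?_⟩
  rw [slope_def_field, sub_zero, hg0, div_lt_iff₀ hs0, zero_mul, sub_neg] at hs
  exact hs

open Classical in
/-- Words whose projection to `Q` is atypically likely are exponentially rare. -/
lemma exists_sum_wordWeight_atypical_le {α : Antichain P → ℝ} (hα : α ∈ weightings P)
    (hpos : ∀ S, 0 < α S) (Q : Finset P) {h : ℝ} (hh : h < entropy Q (inducedWeighting Q α)) :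
    ∃ r : ℝ, 0 ≤ r ∧ r < 1 ∧ ∀ n : ℕ, ∑ w : Fin n → Antichain P with
      Real.exp (-(n * h)) < ∏ i, inducedWeighting Q α (shadow Q (w i).1), wordWeight α w ≤ r ^ n := by
  obtain ⟨s, hs, hlt⟩ := exists_exp_moment_lt_one hα Q hh
  refine ⟨_, Finset.sum_nonneg fun S _ => mul_nonneg (hα.1 S) (Real.exp_pos _).le, hlt,
    fun n => ?_⟩
  rw [Finset.sum_pow', Fintype.piFinset_univ]
  calc _ ≤ ∑ w : Fin n → Antichain P with
            Real.exp (-(n * h)) < ∏ i, inducedWeighting Q α (shadow Q (w i).1),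
          ∏ i, (α (w i) *
            Real.exp (s * (h + Real.log (inducedWeighting Q α (shadow Q (w i).1))))) := by
        refine Finset.sum_le_sum fun w hw => ?_
        rw [Finset.prod_mul_distrib, ← Real.exp_sum]
        -- Exponential Markov inequality: on an atypical word the exponent is nonnegative. Full
        -- support of `α` makes all the logarithms genuine.
        refine le_mul_of_one_le_right (wordWeight_nonneg hα w) (Real.one_le_exp ?_)
        rw [← Finset.mul_sum, Finset.sum_add_distrib]
        refine mul_nonneg hs.le ?_
        have hpos' : ∀ i, 0 < inducedWeighting Q α (shadow Q (w i).1) := fun i =>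
          (hpos _).trans_le (le_inducedWeighting_shadow Q hα _)
        have := (Real.lt_log_iff_exp_lt (Finset.prod_pos fun i _ => hpos' i)).2
          (Finset.mem_filter.1 hw).2
        rw [Real.log_prod fun i _ => (hpos' i).ne'] at this
        simp only [Finset.sum_const, Finset.card_univ, Fintype.card_fin, nsmul_eq_mul]
        linarith
    _ ≤ _ := Finset.sum_le_sum_of_subset_of_nonneg (Finset.filter_subset _ _) fun w _ _ =>
        Finset.prod_nonneg fun i _ => mul_nonneg (hα.1 _) (Real.exp_pos _).le

/-- The word `w` encodes an order embedding, and all of its projections are typical. -/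
def IsGood (α : Antichain P → ℝ) (h : Finset P → ℝ) {n : ℕ} (w : Fin n → Antichain P) : Prop :=
  (∀ x y, wordMap (fun i => (w i).1) x ≤ wordMap (fun i => (w i).1) y → x ≤ y) ∧
    ∀ Q : Finset P, Q.Nonempty →
      ∏ i, inducedWeighting Q α (shadow Q (w i).1) ≤ Real.exp (-(n * h Q))

lemma IsGood.injective {α : Antichain P → ℝ} {h : Finset P → ℝ} {n : ℕ} {w : Fin n → Antichain P}
    (hw : IsGood α h w) : Function.Injective (wordMap fun i => (w i).1) :=
  fun x y hxy => le_antisymm (hw.1 x y hxy.le) (hw.1 y x hxy.ge)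

/-- A position with letter `{x}` belongs to the image of `x` but not to that of `y`. Failure to
reflect the order thus forces a letter to be missing, which is exponentially unlikely. -/
lemma avoid_singletonAntichain {n : ℕ} {w : Fin n → Antichain P} {x y : P} (hxy : ¬ x ≤ y)
    (h : wordMap (fun i => (w i).1) x ≤ wordMap (fun i => (w i).1) y) (i : Fin n) :
    w i ≠ singletonAntichain x := by
  intro hi
  have hmem : i ∈ wordMap (fun i => (w i).1) x := mem_wordMap.2 ⟨x, by simp [hi,
    singletonAntichain], le_rfl⟩
  obtain ⟨t, ht, hty⟩ := mem_wordMap.1 (h hmem)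
  simp only [hi, singletonAntichain, Finset.mem_singleton] at ht
  exact hxy (ht ▸ hty)

open Classical in
/-- The total probability of the words that are not good tends to `0`. -/
lemma tendsto_sum_wordWeight_good {α : Antichain P → ℝ} (hα : α ∈ weightings P)
    (hpos : ∀ S, 0 < α S) {h : Finset P → ℝ}
    (hh : ∀ Q : Finset P, Q.Nonempty → h Q < entropy Q (inducedWeighting Q α)) :
    ∀ᶠ n : ℕ in atTop,
      (1 / 2 : ℝ) ≤ ∑ w : Fin n → Antichain P with IsGood α h w, wordWeight α w := by
  have hr : ∀ Q : Finset P, ∃ r : ℝ, 0 ≤ r ∧ r < 1 ∧ (Q.Nonempty → ∀ n : ℕ,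
      ∑ w : Fin n → Antichain P with
        Real.exp (-(n * h Q)) < ∏ i, inducedWeighting Q α (shadow Q (w i).1),
        wordWeight α w ≤ r ^ n) := by
    intro Q
    by_cases hQ : Q.Nonempty
    · obtain ⟨r, hr0, hr1, hr⟩ := exists_sum_wordWeight_atypical_le hα hpos Q (hh Q hQ)
      exact ⟨r, hr0, hr1, fun _ => hr⟩
    · exact ⟨0, le_rfl, one_pos, fun h => absurd h hQ⟩
  choose r hr0 hr1 hr using hr
  -- Union bound: the first sum pays for atypical projections, the second for pairs `x, y` whose
  -- order is not reflected.
  let b : ℕ → ℝ := fun n => ∑ Q : Finset P, r Q ^ n +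
    ∑ x : P, ∑ _y : P, (1 - α (singletonAntichain x)) ^ n
  have hα1 : ∀ S, α S ≤ 1 := fun S => by
    rw [← hα.2]
    exact Finset.single_le_sum (fun S _ => hα.1 S) (Finset.mem_univ S)
  have hb : Tendsto b atTop (𝓝 0) := by
    have h1 : Tendsto (fun n : ℕ => ∑ Q : Finset P, r Q ^ n) atTop (𝓝 0) := by
      simpa using tendsto_finsetSum Finset.univ fun Q _ =>
        tendsto_pow_atTop_nhds_zero_of_lt_one (hr0 Q) (hr1 Q)
    have h2 : Tendsto (fun n : ℕ => ∑ x : P, ∑ _y : P, (1 - α (singletonAntichain x)) ^ n)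
        atTop (𝓝 0) := by
      simpa using tendsto_finsetSum Finset.univ fun x (_ : x ∈ (Finset.univ : Finset P)) =>
        tendsto_finsetSum Finset.univ fun y (_ : y ∈ (Finset.univ : Finset P)) =>
          tendsto_pow_atTop_nhds_zero_of_lt_one (sub_nonneg.2 (hα1 (singletonAntichain x)))
            (sub_lt_self 1 (hpos (singletonAntichain x)))
    simpa [b] using h1.add h2
  filter_upwards [hb.eventually_lt_const (show (0 : ℝ) < 1 / 2 by norm_num)] with n hn
  have hsplit := Finset.sum_filter_add_sum_filter_not Finset.univ
    (fun w : Fin n → Antichain P => IsGood α h w) (wordWeight α)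
  rw [sum_wordWeight hα] at hsplit
  suffices ∑ w : Fin n → Antichain P with ¬ IsGood α h w, wordWeight α w ≤ b n by linarith
  calc ∑ w : Fin n → Antichain P with ¬ IsGood α h w, wordWeight α w
      ≤ ∑ w : Fin n → Antichain P, (∑ Q : Finset P, (if Q.Nonempty ∧ Real.exp (-(n * h Q)) <
            ∏ i, inducedWeighting Q α (shadow Q (w i).1) then wordWeight α w else 0) +
          ∑ x : P, ∑ _y : P, if ∀ i, w i ≠ singletonAntichain x then wordWeight α w else 0) := by
        rw [Finset.sum_filter]
        refine Finset.sum_le_sum fun w _ => ?_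
        have hw0 := wordWeight_nonneg hα w
        have hn1 : ∀ Q : Finset P, 0 ≤ (if Q.Nonempty ∧ Real.exp (-(n * h Q)) <
            ∏ i, inducedWeighting Q α (shadow Q (w i).1) then wordWeight α w else 0) :=
          fun Q => by split_ifs <;> simp [hw0]
        have hn2 : ∀ x : P, 0 ≤ (if ∀ i, w i ≠ singletonAntichain x then wordWeight α w else 0) :=
          fun x => by split_ifs <;> simp [hw0]
        have hs1 := Finset.sum_nonneg fun Q (_ : Q ∈ (Finset.univ : Finset (Finset P))) => hn1 Q
        have hs2 := Finset.sum_nonneg fun x (_ : x ∈ (Finset.univ : Finset P)) =>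
          Finset.sum_nonneg fun y (_ : y ∈ (Finset.univ : Finset P)) => hn2 x
        split_ifs with hg
        · exact add_nonneg hs1 hs2
        · rw [IsGood, not_and_or] at hg
          rcases hg with hg | hg
          · push Not at hg
            obtain ⟨x, y, hle, hxy⟩ := hg
            have h1 := Finset.single_le_sum (f := fun x : P => ∑ _y : P,
              if ∀ i, w i ≠ singletonAntichain x then wordWeight α w else 0)
              (fun x _ => Finset.sum_nonneg fun y _ => hn2 x) (Finset.mem_univ x)
            have h2 := Finset.single_le_sum (f := fun _y : P =>
              if ∀ i, w i ≠ singletonAntichain x then wordWeight α w else 0)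
              (fun y _ => hn2 x) (Finset.mem_univ y)
            simp only [if_pos (avoid_singletonAntichain hxy hle)] at h1 h2
            exact (h2.trans h1).trans (le_add_of_nonneg_left hs1)
          · push Not at hg
            obtain ⟨Q, hQ, hlt⟩ := hg
            have h1 := Finset.single_le_sum (fun Q _ => hn1 Q) (Finset.mem_univ Q)
            rw [if_pos ⟨hQ, hlt⟩] at h1
            exact h1.trans (le_add_of_nonneg_right hs2)
    _ ≤ b n := by
        rw [Finset.sum_add_distrib, Finset.sum_comm]
        refine add_le_add (Finset.sum_le_sum fun Q _ => ?_) ?_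
        · by_cases hQ : Q.Nonempty
          · simp only [hQ, true_and]
            rw [← Finset.sum_filter]
            exact hr Q hQ n
          · simp only [hQ, false_and, if_false, Finset.sum_const_zero]
            exact pow_nonneg (hr0 Q) n
        · rw [Finset.sum_comm]
          refine Finset.sum_le_sum fun x _ => ?_
          rw [Finset.sum_comm]
          refine Finset.sum_le_sum fun y _ => ?_
          rw [← Finset.sum_filter, sum_wordWeight_avoid hα]

end Words

/-! ### Overlapping pairs of good words, and the embedding below the threshold. -/

section LowerBound

variable {P : Type*} [PartialOrder P] [Fintype P]

open Classical in
/-- The image of the order-preserving map encoded by `w`. -/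
def wordFamily {n : ℕ} (w : Fin n → Antichain P) : Finset (Finset (Fin n)) :=
  Finset.univ.image (wordMap fun i => (w i).1)

lemma IsGood.card_wordFamily {α : Antichain P → ℝ} {h : Finset P → ℝ} {n : ℕ}
    {w : Fin n → Antichain P} (hw : IsGood α h w) : (wordFamily w).card = Fintype.card P := by
  rw [wordFamily, Finset.card_image_of_injective _ hw.injective, Finset.card_univ]

lemma IsGood.isInducedSubposet {α : Antichain P → ℝ} {h : Finset P → ℝ} {n : ℕ}
    {w : Fin n → Antichain P} (hw : IsGood α h w) {F : Set (Finset (Fin n))}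
    (hF : ∀ A ∈ wordFamily w, A ∈ F) : IsInducedSubposet P F := by
  classical
  refine ⟨fun x => ⟨wordMap (fun i => (w i).1) x,
    hF _ (Finset.mem_image_of_mem _ (Finset.mem_univ x))⟩, fun x y hxy => ?_, fun x y => ?_⟩
  · exact hw.injective (Subtype.ext_iff.1 hxy)
  · exact ⟨fun hle => hw.1 x y hle, fun hxy => wordMap_mono _ hxy⟩

open Classical in
/-- The good words with prescribed values on `Q` have small total probability. -/
lemma sum_wordWeight_extension_le {α : Antichain P → ℝ} (hα : α ∈ weightings P)
    (h : Finset P → ℝ) {n : ℕ} {Q : Finset P} (hQ : Q.Nonempty) (ψ : P → Finset (Fin n)) :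
    ∑ v : Fin n → Antichain P with IsGood α h v ∧ ∀ y ∈ Q, wordMap (fun i => (v i).1) y = ψ y,
      wordWeight α v ≤ Real.exp (-(n * h Q)) := by
  -- Any good `v₀` with these values determines the shadow word on `Q` of all the others, and
  -- typicality of `v₀` bounds the probability of that word.
  by_cases hex : ∃ v₀ : Fin n → Antichain P,
      IsGood α h v₀ ∧ ∀ y ∈ Q, wordMap (fun i => (v₀ i).1) y = ψ y
  · obtain ⟨v₀, hv₀, hψ⟩ := hex
    refine le_trans ?_ (hv₀.2 Q hQ)
    rw [← sum_wordWeight_shadow_eq]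
    refine Finset.sum_le_sum_of_subset_of_nonneg (fun v hv => ?_)
      fun v _ _ => wordWeight_nonneg hα v
    have hv' := (Finset.mem_filter.1 hv).2.2
    exact Finset.mem_filter.2 ⟨Finset.mem_univ _, shadow_eq_of_wordMap_eq
      (u := fun i => (v i).1) (v := fun i => (v₀ i).1) fun y hy => by rw [hv' y hy, hψ y hy]⟩
  · rw [Finset.filter_false_of_mem fun v _ hv => hex ⟨v, hv⟩, Finset.sum_empty]
    exact (Real.exp_pos _).le

open Classical in
/-- The set of elements whose image under the map encoded by `v` is also in the image of the map
encoded by `w`. -/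
def overlap {n : ℕ} (w v : Fin n → Antichain P) : Finset P :=
  {y | wordMap (fun i => (v i).1) y ∈ wordFamily w}

open Classical in
lemma IsGood.card_overlap {α : Antichain P → ℝ} {h : Finset P → ℝ} {n : ℕ}
    {w v : Fin n → Antichain P} (hv : IsGood α h v) :
    (wordFamily w ∩ wordFamily v).card = (overlap w v).card := by
  rw [← Finset.card_image_of_injective (overlap w v) hv.injective]
  congr 1
  ext A
  simp only [wordFamily, overlap, Finset.mem_inter, Finset.mem_image, Finset.mem_filter,
    Finset.mem_univ, true_and]
  constructor
  · rintro ⟨hA, y, rfl⟩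
    exact ⟨y, hA, rfl⟩
  · rintro ⟨y, hy, rfl⟩
    exact ⟨hy, y, rfl⟩

/-- On the overlap `v` takes the values of `w ∘ σ`, so a union bound over `σ` reduces overlaps to
prescribed values. Only the number of maps `σ` matters. -/
lemma exists_overlap_map {n : ℕ} (w v : Fin n → Antichain P) :
    ∃ σ : P → P, ∀ y ∈ overlap w v,
      wordMap (fun i => (v i).1) y = wordMap (fun i => (w i).1) (σ y) := by
  classical
  have : ∀ y, ∃ x, y ∈ overlap w v →
      wordMap (fun i => (v i).1) y = wordMap (fun i => (w i).1) x := by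
    intro y
    by_cases hy : y ∈ overlap w v
    · obtain ⟨x, -, hx⟩ := Finset.mem_image.1 (Finset.mem_filter.1 hy).2
      exact ⟨x, fun _ => hx.symm⟩
    · exact ⟨y, fun h => absurd h hy⟩
  choose σ hσ using this
  exact ⟨σ, hσ⟩

open Classical in
/-- The contribution of the overlapping pairs of good words to the second moment. -/
lemma sum_overlap_le {α : Antichain P → ℝ} (hα : α ∈ weightings P) (h : Finset P → ℝ) {n : ℕ}
    {q : ℝ} (hq : 0 ≤ q) :
    ∑ w : Fin n → Antichain P with IsGood α h w, ∑ v : Fin n → Antichain P with IsGood α h v,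
      (if wordFamily w ∩ wordFamily v = ∅ then 0 else
        wordWeight α w * wordWeight α v * q ^ (wordFamily w ∩ wordFamily v).card) ≤
      Fintype.card (P → P) *
        ∑ Q : Finset P with Q.Nonempty, q ^ Q.card * Real.exp (-(n * h Q)) := by
  -- Once `w`, `Q` and `σ` are fixed, `R` prescribes `v` on `Q`, so `sum_wordWeight_extension_le`
  -- bounds the sum over `v`.
  let R : Finset P → (P → P) → (Fin n → Antichain P) → (Fin n → Antichain P) → Prop :=
    fun Q σ w v => ∀ y ∈ Q, wordMap (fun i => (v i).1) y = wordMap (fun i => (w i).1) (σ y)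
  have hterm : ∀ w v : Fin n → Antichain P, IsGood α h v →
      (if wordFamily w ∩ wordFamily v = ∅ then 0 else
        wordWeight α w * wordWeight α v * q ^ (wordFamily w ∩ wordFamily v).card) ≤
      ∑ Q : Finset P with Q.Nonempty, ∑ σ : P → P,
        wordWeight α w * q ^ Q.card * (if R Q σ w v then wordWeight α v else 0) := by
    intro w v hv
    have hn : ∀ (Q : Finset P) (σ : P → P), 0 ≤
        wordWeight α w * q ^ Q.card * (if R Q σ w v then wordWeight α v else 0) := fun Q σ => by
      have := wordWeight_nonneg hα w
      have := wordWeight_nonneg hα v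
      split_ifs <;> positivity
    split_ifs with hne
    · exact Finset.sum_nonneg fun Q _ => Finset.sum_nonneg fun σ _ => hn Q σ
    · obtain ⟨σ, hσ⟩ := exists_overlap_map w v
      have hQ : (overlap w v).Nonempty := by
        rw [← Finset.card_pos, ← hv.card_overlap, Finset.card_pos]
        exact Finset.nonempty_iff_ne_empty.2 hne
      have h1 := Finset.single_le_sum (f := fun Q : Finset P => ∑ σ : P → P,
        wordWeight α w * q ^ Q.card * (if R Q σ w v then wordWeight α v else 0))
        (s := Finset.univ.filter Finset.Nonempty)
        (fun Q _ => Finset.sum_nonneg fun σ _ => hn Q σ)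
        (Finset.mem_filter.2 ⟨Finset.mem_univ _, hQ⟩)
      have h2 := Finset.single_le_sum (fun σ _ => hn (overlap w v) σ) (Finset.mem_univ σ)
      refine le_trans (le_of_eq ?_) (h2.trans h1)
      rw [if_pos hσ, hv.card_overlap]
      ring
  calc _ ≤ ∑ w : Fin n → Antichain P with IsGood α h w,
          ∑ v : Fin n → Antichain P with IsGood α h v,
            ∑ Q : Finset P with Q.Nonempty, ∑ σ : P → P,
              wordWeight α w * q ^ Q.card * (if R Q σ w v then wordWeight α v else 0) :=
        Finset.sum_le_sum fun w _ => Finset.sum_le_sum fun v hv =>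
          hterm w v (Finset.mem_filter.1 hv).2
    _ ≤ ∑ w : Fin n → Antichain P with IsGood α h w,
          ∑ Q : Finset P with Q.Nonempty, ∑ _σ : P → P,
            wordWeight α w * q ^ Q.card * Real.exp (-(n * h Q)) := by
        refine Finset.sum_le_sum fun w _ => ?_
        rw [Finset.sum_comm]
        refine Finset.sum_le_sum fun Q hQ => ?_
        rw [Finset.sum_comm]
        refine Finset.sum_le_sum fun σ _ => ?_
        rw [← Finset.mul_sum, ← Finset.sum_filter, Finset.filter_filter]
        exact mul_le_mul_of_nonneg_left
          (sum_wordWeight_extension_le hα h (Finset.mem_filter.1 hQ).2 _)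
          (mul_nonneg (wordWeight_nonneg hα w) (pow_nonneg hq _))
    _ = (∑ w : Fin n → Antichain P with IsGood α h w, wordWeight α w) *
          (Fintype.card (P → P) *
            ∑ Q : Finset P with Q.Nonempty, q ^ Q.card * Real.exp (-(n * h Q))) := by
        rw [Finset.sum_mul]
        refine Finset.sum_congr rfl fun w _ => ?_
        simp only [Finset.sum_const, Finset.card_univ, nsmul_eq_mul, Finset.mul_sum]
        exact Finset.sum_congr rfl fun Q _ => by ring
    _ ≤ _ := by
        refine mul_le_of_le_one_left ?_ ?_
        · exact mul_nonneg (Nat.cast_nonneg _) (Finset.sum_nonneg fun Q _ =>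
            mul_nonneg (pow_nonneg hq _) (Real.exp_pos _).le)
        · rw [← sum_wordWeight hα n]
          exact Finset.sum_le_sum_of_subset_of_nonneg (Finset.filter_subset _ _)
            fun w _ _ => wordWeight_nonneg hα w

/-- Below the critical exponent, `P` is with high probability an induced subposet. -/
theorem tendsto_law_isInducedSubposet [Nonempty P] {c : ℝ} (hc : 0 < c)
    (hlt : c < criticalExponent P) :
    Tendsto (fun n : ℕ => law n (retentionProb c hc n)
      {F : Set (Finset (Fin n)) | IsInducedSubposet P F}) atTop (𝓝 1) := by
  classical
  obtain ⟨α, hα, hpos, hexp⟩ := exists_pos_weighting_of_lt_criticalExponent hlt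
  have hH : ∀ Q : Finset P, Q.Nonempty → c * Q.card < entropy Q (inducedWeighting Q α) :=
    fun Q hQ => (lt_div_iff₀ (by exact_mod_cast hQ.card_pos)).1 (hexp Q hQ)
  -- The midpoint leaves a gap on both sides: below the entropy for typicality, above `c * |Q|` for
  -- decay of the overlap terms.
  let h : Finset P → ℝ := fun Q => (c * Q.card + entropy Q (inducedWeighting Q α)) / 2
  have hh : ∀ Q : Finset P, Q.Nonempty → h Q < entropy Q (inducedWeighting Q α) :=
    fun Q hQ => by have := hH Q hQ; simp only [h]; linarith
  let δ : ℕ → ℝ := fun n => Fintype.card (P → P) *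
    ∑ Q : Finset P with Q.Nonempty, Real.exp (-((h Q - c * Q.card) * n))
  have hδ : Tendsto δ atTop (𝓝 0) := by
    have h1 : Tendsto (fun n : ℕ => ∑ Q : Finset P with Q.Nonempty,
        Real.exp (-((h Q - c * Q.card) * n))) atTop (𝓝 0) := by
      rw [← Finset.sum_const_zero (s := Finset.univ.filter fun Q : Finset P => Q.Nonempty)]
      refine tendsto_finsetSum _ fun Q hQ => ?_
      have hgap : 0 < h Q - c * Q.card := by
        have := hH Q (Finset.mem_filter.1 hQ).2
        simp only [h]
        linarith
      simpa using tendsto_add_one_pow_mul_exp_neg hgap 0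
    simpa [δ] using h1.const_mul (Fintype.card (P → P) : ℝ)
  -- The factor `4` is `(1 / 2)⁻²`, as good words have total weight at least `1 / 2`.
  have hδ4 : Tendsto (fun n => 4 * δ n) atTop (𝓝 0) := by simpa using hδ.const_mul 4
  refine tendsto_law_one hδ4 ?_
  filter_upwards [tendsto_sum_wordWeight_good hα hpos hh] with n hn
  let G : Finset (Fin n → Antichain P) := Finset.univ.filter fun w => IsGood α h w
  let p := retentionProb c hc n
  have hp : 0 < (p : ℝ) := Real.exp_pos _
  have hmoment := law_real_not_retained_mul_le hp G (wordWeight α) (wordWeight_nonneg hα)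
    wordFamily (k := Fintype.card P) fun w hw => (Finset.mem_filter.1 hw).2.card_wordFamily
  have hsub : {F : Set (Finset (Fin n)) | IsInducedSubposet P F}ᶜ ⊆
      {F | ∀ w ∈ G, ¬ ∀ A ∈ wordFamily w, A ∈ F} := fun F hF w hw hwF =>
    hF ((Finset.mem_filter.1 hw).2.isInducedSubposet hwF)
  have hle := measureReal_mono hsub (measure_ne_top (law n p) _)
  have hpow : ∀ Q : Finset P, ((p : ℝ)⁻¹) ^ Q.card * Real.exp (-(n * h Q)) =
      Real.exp (-((h Q - c * Q.card) * n)) := fun Q => by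
    have : (p : ℝ)⁻¹ = Real.exp (c * n) := by
      rw [show (p : ℝ) = Real.exp (-c * n) from rfl, ← Real.exp_neg]
      congr 1
      ring
    rw [this, ← Real.exp_nat_mul, ← Real.exp_add]
    congr 1
    ring
  have hover := sum_overlap_le hα h (n := n) (inv_nonneg.2 hp.le)
  simp only [hpow] at hover
  have htotal := hmoment.trans hover
  have hnonneg : 0 ≤ (law n p).real {F | ∀ w ∈ G, ¬ ∀ A ∈ wordFamily w, A ∈ F} :=
    measureReal_nonneg
  have hsq : (1 / 4 : ℝ) ≤ (∑ w ∈ G, wordWeight α w) ^ 2 :=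
    le_trans (by norm_num) (pow_le_pow_left₀ (by norm_num) hn 2)
  have := mul_le_mul_of_nonneg_left hsq hnonneg
  change (law n p).real _ ≤ 4 * δ n
  change _ ≤ δ n at htotal
  linarith

end LowerBound

end

end RandomPoset

theorem mainTheorem1 (P : Type*) [PartialOrder P] [Fintype P] [Nonempty P] :
    IsGreatest {m : ℝ | ∃ α ∈ RandomPoset.weightings P,
        IsLeast {x : ℝ | ∃ Q : Finset P, Q.Nonempty ∧ x = RandomPoset.exponentAt α Q} m}
      (RandomPoset.criticalExponent P) ∧
    ∀ (c : ℝ) (hc : 0 < c),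
      (RandomPoset.criticalExponent P < c →
        Tendsto (fun n : ℕ => (RandomPoset.law n (RandomPoset.retentionProb c hc n))
          {F : Set (Finset (Fin n)) | ¬ RandomPoset.IsSubposet P F}) atTop (𝓝 1)) ∧
      (c < RandomPoset.criticalExponent P →
        Tendsto (fun n : ℕ => (RandomPoset.law n (RandomPoset.retentionProb c hc n))
          {F : Set (Finset (Fin n)) | RandomPoset.IsInducedSubposet P F}) atTop (𝓝 1)) :=
  ⟨RandomPoset.isGreatest_criticalExponent, fun _ hc =>
    ⟨RandomPoset.tendsto_law_not_isSubposet hc, RandomPoset.tendsto_law_isInducedSubposet hc⟩⟩
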